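/- Let $(a_f)$, $f:\{0,1\}^2\to\{0,1\}$, be numbers $a_f\in[0,1]$ with $\sum_f a_f=1$. Call $f$ canalyzing if there are an argument of $f$ and values $u,v\in\{0,1\}$ such that $f$ takes the value $v$ whenever that argument equals $u$. Let $\mathcal A$ be the set of the two constant functions, $\mathcal B_1$ (respectively $\mathcal B_2$) the set of canalyzing functions that depend on exactly one (respectively on both) of their arguments, and $\mathcal C$ the set of non-canalyzing functions (equivalence and exclusive or). Put $a=\sum_{f\in\mathcal A}a_f$ and $c=\sum_{f\in\mathcal C}a_f$. Assume that $a_f=a_{\neg f}$ for all $f\in\mathcal A\cup\mathcal B_2$, and that $a_{f(x,y)}=a_{f(y,x)}$ for all $f\in\mathcal B_1$. For $n\ge 2$ let $\tilde B$ be the random boolean cellular automaton with gates $1,\dots,n$ obtained as follows: independently for each gate $i$, its two inputs $j_i<k_i$ are chosen uniformly among the $\binom n2$ two-element subsets of $\{1,\dots,n\}$ and, independently of these choices and of the other gates, gate $i$ is assigned a function $f_i$, which is $f$ with probability $a_f$. It defines the map $\tilde B(x)=(f_1(x_{j_1},x_{k_1}),\dots,f_n(x_{j_n},x_{k_n}))$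 on $\{0,1\}^n$. For $x\in\{0,1\}^n$ let $t_1$ be the first time such that $\tilde B^{t_0}(x)=\tilde B^{t_1}(x)$ for some $t_0<t_1$; the state cycle of $x$ is the set $\{\tilde B^t(x):t\ge t_0\}$, and the state cycles of $\tilde B$ are those of all $x\in\{0,1\}^n$. If $a>c$ and $\omega:\mathbb N\to\mathbb R$ is any unbounded increasing (not necessarily strictly) function, then $$\lim_{n\to\infty}\Pr\bigl(\tilde B\text{ has a state cycle with more than }\omega(n)\text{ elements}\bigr)=0.$$ -/

import Mathlib

namespace BoolAut

/-- Boolean functions of two arguments. -/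
abbrev BoolFn := Bool → Bool → Bool

/-- `f` depends on its first argument. -/
def DependsFst (f : BoolFn) : Prop := ∃ v, f false v ≠ f true v

/-- `f` depends on its second argument. -/
def DependsSnd (f : BoolFn) : Prop := ∃ v, f v false ≠ f v true

/-- Some value `u` of one of the two arguments forces the value of `f` to be a fixed `v`. -/
def Canalyzing (f : BoolFn) : Prop :=
  (∃ u v, ∀ y, f u y = v) ∨ (∃ u v, ∀ x, f x u = v)

/-- The two constant functions. -/
def classA : Set BoolFn := {f | ∃ v, ∀ x y, f x y = v}

/-- The canalyzing functions that depend on exactly one argument. -/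
def classB₁ : Set BoolFn := {f | Canalyzing f ∧
  ((DependsFst f ∧ ¬ DependsSnd f) ∨ (DependsSnd f ∧ ¬ DependsFst f))}

/-- The canalyzing functions that depend on both arguments. -/
def classB₂ : Set BoolFn := {f | Canalyzing f ∧ DependsFst f ∧ DependsSnd f}

/-- The non-canalyzing functions. -/
def classC : Set BoolFn := {f | ¬ Canalyzing f}

/-- The total probability that `a` gives to the functions in `S`. -/
noncomputable def mass (a : BoolFn → ℝ) (S : Set BoolFn) : ℝ :=
  ∑ f : BoolFn, S.indicator a f

/-- The possible choices of the two inputs of a gate: a two-element set of gates, written as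
its increasing pair `(j, k)`, `j < k`. A gate may be an input of itself. -/
abbrev InputPair (n : ℕ) := {p : Fin n × Fin n // p.1 < p.2}

/-- A boolean cellular automaton `⟨D, f⟩` with `n` gates. The digraph `D` of indegree two is
given by the inputs of each gate, and `f` gives the boolean function of each gate. -/
abbrev Automaton (n : ℕ) := (Fin n → InputPair n) × (Fin n → BoolFn)

/-- The map on states defined by an automaton. -/
def step {n : ℕ} (B : Automaton n) (x : Fin n → Bool) : Fin n → Bool :=
  fun i => B.2 i (x (B.1 i).1.1) (x (B.1 i).1.2)

/-- The state at time `t` of the automaton started in `x`. -/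
def stateAt {n : ℕ} (B : Automaton n) (x : Fin n → Bool) (t : ℕ) : Fin n → Bool :=
  (step B)^[t] x

/-- `t₁` is the first time at which a state is repeated, and `t₀ < t₁` is the
(unique) earlier time at which that state occurred. -/
def IsFirstRepeat {n : ℕ} (B : Automaton n) (x : Fin n → Bool) (t₀ t₁ : ℕ) : Prop :=
  t₀ < t₁ ∧ stateAt B x t₀ = stateAt B x t₁ ∧
    ∀ s t, s < t → t < t₁ → stateAt B x s ≠ stateAt B x t

/-- The state cycle of `x`: the states at the times `t ≥ t₀`. -/
def stateCycle {n : ℕ} (B : Automaton n) (x : Fin n → Bool) : Set (Fin n → Bool) :=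
  {y | ∃ t₀ t₁, IsFirstRepeat B x t₀ t₁ ∧ ∃ t, t₀ ≤ t ∧ y = stateAt B x t}

/-- `B` has a state cycle with more than `s` states. -/
def HasStateCycleLargerThan {n : ℕ} (B : Automaton n) (s : ℝ) : Prop :=
  ∃ x, s < ((stateCycle B x).ncard : ℝ)

/-- The probability of the automaton `B`: independently for each gate, its inputs are one of
`n.choose 2` equally likely pairs, and its function is `f` with probability `a f`. -/
noncomputable def weight (a : BoolFn → ℝ) {n : ℕ} (B : Automaton n) : ℝ :=
  ∏ i : Fin n, ((n.choose 2 : ℝ)⁻¹ * a (B.2 i))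

/-- The probability that the random automaton with `n` gates has the property `P`
(meaningful for `n ≥ 2`, since otherwise a gate has no possible pair of inputs). -/
noncomputable def pr (a : BoolFn → ℝ) (n : ℕ) (P : Automaton n → Prop) : ℝ :=
  ∑ B : Automaton n, {B | P B}.indicator (weight a) B

end BoolAut

/-! Call a gate frozen if from some time on it has a value that does not depend on the initial
state. On a state cycle the frozen gates are constant, so a cycle has at most 2 to the number of
non-frozen gates elements (`ncard_stateCycle_le`). It therefore suffices that the expected number of
non-frozen gates is bounded in n (`exists_expect_not_frozen_le`); Markov's inequality does the rest.

A local search certifies frozenness. Follow the inputs of a gate backwards to depth m, treat the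
values at the leaves as unknown, and propagate what is forced. As long as no gate is met twice, the
search sees a binary tree with independent random functions. The symmetry under negation keeps a
forced value unbiased, and the probability p of not being forced obeys p ↦ p(1 - a + c) - cp², hence
tends to 0 because a > c (`sum_law_unforcedStep`, `exists_unforced_lt`).

A non-frozen gate has a non-frozen input through which a change can still pass, whatever has been
certified about the other input (`exists_input_not_frozen`). So it starts backward transmitting
paths of every length l. The mean number of transmitting inputs of a gate is at most μ = 1 - a + c +
p, which is below 1 once m is large. The paths thus form a subcritical branching process, with mean
at most μ^l plus an O(1/n) error from collisions (`exists_expect_paths_le`). With l so large that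
μ^l < 1/n, summing over the n gates gives a bound independent of n. -/

namespace BoolAut

open Finset

/-! ### Expectation under a product measure -/

section Expectation

variable {ι G : Type*} [Fintype ι] [DecidableEq ι] [Fintype G]

/-- The expectation of `Φ` under the product of the weights `w`. -/
noncomputable def expect (w : G → ℝ) (Φ : (ι → G) → ℝ) : ℝ :=
  ∑ B : ι → G, (∏ i, w (B i)) * Φ B

theorem expect_mono {w : G → ℝ} (hw : ∀ g, 0 ≤ w g) {Φ Ψ : (ι → G) → ℝ} (h : ∀ B, Φ B ≤ Ψ B) :
    expect w Φ ≤ expect w Ψ :=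
  Finset.sum_le_sum fun B _ =>
    mul_le_mul_of_nonneg_left (h B) (Finset.prod_nonneg fun i _ => hw (B i))

theorem expect_add (w : G → ℝ) (Φ Ψ : (ι → G) → ℝ) :
    expect w (fun B => Φ B + Ψ B) = expect w Φ + expect w Ψ := by
  simp only [expect, mul_add, Finset.sum_add_distrib]

theorem expect_sum {κ : Type*} (s : Finset κ) (w : G → ℝ) (Φ : κ → (ι → G) → ℝ) :
    expect w (fun B => ∑ k ∈ s, Φ k B) = ∑ k ∈ s, expect w (Φ k) := by
  simp only [expect, Finset.mul_sum]
  exact Finset.sum_comm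

theorem expect_const_mul (w : G → ℝ) (c : ℝ) (Φ : (ι → G) → ℝ) :
    expect w (fun B => c * Φ B) = c * expect w Φ := by
  simp only [expect, Finset.mul_sum]
  exact Finset.sum_congr rfl fun B _ => by ring

theorem expect_const {w : G → ℝ} (hw : ∑ g, w g = 1) (c : ℝ) :
    expect w (fun _ : ι → G => c) = c := by
  have h : ∑ B : ι → G, ∏ i, w (B i) = 1 := by
    rw [← Fintype.piFinset_univ, Finset.sum_prod_piFinset]
    simp [hw]
  rw [expect, ← Finset.sum_mul, h, one_mul]

/-- Revealing the coordinate `v` first. -/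
theorem expect_reveal {w : G → ℝ} (hw : ∑ g, w g = 1) (v : ι) (Φ : G → (ι → G) → ℝ)
    (hΦ : ∀ g, DependsOn (Φ g) {v}ᶜ) :
    expect w (fun B => Φ (B v) B) = ∑ g, w g * expect w (Φ g) := by
  have key : ∀ Ψ : (ι → G) → ℝ, expect w Ψ = ∑ g, ∑ h : {j // j ≠ v} → G,
      w g * (∏ j, w (h j)) * Ψ ((Equiv.funSplitAt v G).symm (g, h)) := by
    intro Ψ
    rw [expect, ← Fintype.sum_prod_type', ← (Equiv.funSplitAt v G).symm.sum_comp]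
    refine Finset.sum_congr rfl fun x _ => ?_
    congr 1
    rw [Fintype.prod_eq_mul_prod_subtype_ne _ v]
    congr 1
    · simp [Equiv.funSplitAt, Equiv.piSplitAt]
    · refine Finset.prod_congr rfl fun j _ => ?_
      simp [Equiv.funSplitAt, Equiv.piSplitAt, j.2]
  have hind : ∀ g g' g'' h, Φ g ((Equiv.funSplitAt v G).symm (g', h)) =
      Φ g ((Equiv.funSplitAt v G).symm (g'', h)) := by
    intro g g' g'' h
    refine hΦ g fun i hi => ?_
    have : i ≠ v := hi
    simp [Equiv.funSplitAt, Equiv.piSplitAt, this]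
  rw [key]
  refine Finset.sum_congr rfl fun g _ => ?_
  rw [key, Finset.sum_comm, Finset.mul_sum]
  refine Finset.sum_congr rfl fun h _ => ?_
  have hv : (Equiv.funSplitAt v G).symm (g, h) v = g := by
    simp [Equiv.funSplitAt, Equiv.piSplitAt]
  rw [hv]
  calc w g * (∏ j, w (h j)) * Φ g ((Equiv.funSplitAt v G).symm (g, h))
      = w g * ((∑ g', w g') *
          ((∏ j, w (h j)) * Φ g ((Equiv.funSplitAt v G).symm (g, h)))) := by rw [hw]; ring
    _ = w g * ∑ g', w g' * (∏ j, w (h j)) * Φ g ((Equiv.funSplitAt v G).symm (g', h)) := by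
        rw [Finset.sum_mul]
        congr 1
        refine Finset.sum_congr rfl fun g' _ => ?_
        rw [hind g g' g h]; ring

end Expectation

/-! ### The law of a single gate and the probability of a collision -/

section Gates

/-- The data of one gate: its inputs and its function. -/
abbrev Gate (n : ℕ) := InputPair n × BoolFn

/-- The probability of the data of one gate. -/
noncomputable def gateWeight (a : BoolFn → ℝ) (n : ℕ) (g : Gate n) : ℝ :=
  (n.choose 2 : ℝ)⁻¹ * a g.2

theorem card_inputPair (n : ℕ) : Fintype.card (InputPair n) = n.choose 2 := by
  have h : Fintype.card (InputPair n) = ∑ k : Fin n, (k : ℕ) := by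
    rw [Fintype.card_subtype]
    rw [Finset.card_eq_sum_card_fiberwise (f := Prod.snd) (t := Finset.univ) (by simp)]
    refine Finset.sum_congr rfl fun k _ => ?_
    rw [← Fin.card_Iio k]
    refine Finset.card_bij (fun p _ => p.1) ?_ ?_ ?_
    · rintro ⟨p, q⟩ h
      simp at h ⊢
      exact h.2 ▸ h.1
    · rintro ⟨p, q⟩ h ⟨p', q'⟩ h' e
      simp at h h' e
      simp [e, h.2, h'.2]
    · intro b hb
      exact ⟨(b, k), by simpa using hb, rfl⟩
  rw [h, Fin.sum_univ_eq_sum_range (fun i => i), Finset.sum_range_id, Nat.choose_two_right]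

theorem choose_two_pos {n : ℕ} (hn : 2 ≤ n) : (0 : ℝ) < n.choose 2 := by
  exact_mod_cast Nat.choose_pos hn

theorem gateWeight_nonneg {a : BoolFn → ℝ} (ha : ∀ f, 0 ≤ a f) {n : ℕ} (g : Gate n) :
    0 ≤ gateWeight a n g :=
  mul_nonneg (by positivity) (ha _)

theorem sum_gateWeight_mul {a : BoolFn → ℝ} {n : ℕ} (hn : 2 ≤ n) (φ : BoolFn → ℝ) :
    ∑ g : Gate n, gateWeight a n g * φ g.2 = ∑ f, a f * φ f := by
  rw [Fintype.sum_prod_type]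
  simp only [gateWeight, mul_assoc, ← Finset.mul_sum]
  rw [Finset.sum_const, Finset.card_univ, card_inputPair, nsmul_eq_mul, ← mul_assoc,
    inv_mul_cancel₀ (choose_two_pos hn).ne', one_mul]

theorem sum_gateWeight {a : BoolFn → ℝ} (ha : ∑ f, a f = 1) {n : ℕ} (hn : 2 ≤ n) :
    ∑ g : Gate n, gateWeight a n g = 1 := by
  simpa [ha] using sum_gateWeight_mul (a := a) hn (fun _ => 1)

/-- One of the inputs is in `T`. -/
def Hits {n : ℕ} (p : InputPair n) (T : Finset (Fin n)) : Prop := p.1.1 ∈ T ∨ p.1.2 ∈ T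

instance {n : ℕ} (p : InputPair n) (T : Finset (Fin n)) : Decidable (Hits p T) :=
  inferInstanceAs (Decidable (_ ∨ _))

/-- Each element of `T` lies in n - 1 pairs, which are told apart by their other element. -/
theorem card_hits_le {n : ℕ} (T : Finset (Fin n)) :
    #{p : InputPair n | Hits p T} ≤ #T * (n - 1) := by
  have h1 : ({p : InputPair n | Hits p T} : Finset _) ⊆
      T.biUnion fun t => {p : InputPair n | p.1.1 = t ∨ p.1.2 = t} := by
    intro p hp
    simp only [Finset.mem_filter, Finset.mem_univ, true_and, Finset.mem_biUnion] at hp ⊢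
    rcases hp with h | h
    · exact ⟨_, h, Or.inl rfl⟩
    · exact ⟨_, h, Or.inr rfl⟩
  refine (Finset.card_le_card h1).trans (Finset.card_biUnion_le_card_mul _ _ _ fun t _ => ?_)
  have h2 : #((Finset.univ : Finset (Fin n)).erase t) = n - 1 := by simp
  rw [← h2]
  refine Finset.card_le_card_of_injOn (fun p => if p.1.1 = t then p.1.2 else p.1.1) ?_ ?_
  · rintro ⟨⟨p, q⟩, hpq⟩ h
    simp only [Finset.coe_filter, Finset.mem_univ, true_and, Set.mem_ofPred_eq] at h hpq
    simp only [Finset.coe_erase, Finset.coe_univ, Set.mem_sdiff, Set.mem_univ,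
      Set.mem_singleton_iff, true_and]
    split_ifs with h'
    · rintro rfl; exact hpq.ne h'
    · exact h'
  · rintro ⟨⟨p, q⟩, hpq⟩ h ⟨⟨p', q'⟩, hpq'⟩ h' e
    simp only [Finset.coe_filter, Finset.mem_univ, true_and, Set.mem_ofPred_eq] at h h' hpq hpq' e
    simp only [Subtype.mk.injEq, Prod.mk.injEq]
    split_ifs at e <;> grind

theorem sum_gateWeight_hits_le {a : BoolFn → ℝ} (ha : ∑ f, a f = 1) {n : ℕ} (hn : 2 ≤ n)
    (T : Finset (Fin n)) :
    ∑ g : Gate n, gateWeight a n g * (if Hits g.1 T then 1 else 0) ≤ 2 * #T / n := by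
  rw [Fintype.sum_prod_type]
  have h0 : ∀ p : InputPair n, ∑ f : BoolFn, gateWeight a n (p, f) * (if Hits p T then 1 else 0) =
      (n.choose 2 : ℝ)⁻¹ * (if Hits p T then 1 else 0) := by
    intro p
    simp only [gateWeight]
    rw [← Finset.sum_mul, ← Finset.mul_sum, ha, mul_one]
  simp only [h0]
  rw [← Finset.mul_sum, Finset.sum_boole]
  have hc : (n.choose 2 : ℝ) = n * (n - 1) / 2 := Nat.cast_choose_two ℝ n
  have h1 : (#{p : InputPair n | Hits p T} : ℝ) ≤ #T * (n - 1) := by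
    have := card_hits_le T
    have h3 : ((n - 1 : ℕ) : ℝ) = (n : ℝ) - 1 := by
      rw [Nat.cast_sub (by omega)]; simp
    rw [← h3]; exact_mod_cast this
  have hn' : (2 : ℝ) ≤ n := by exact_mod_cast hn
  rw [hc, inv_mul_le_iff₀ (by nlinarith)]
  refine h1.trans (le_of_eq ?_)
  field_simp

end Gates

/-! ### Forcing with partially known arguments -/

section Ternary

/-- `x` is a possible value of an argument known to be `α` (`none` means unknown). -/
def Compat (α : Option Bool) (x : Bool) : Prop := α = none ∨ α = some x

instance (α : Option Bool) (x : Bool) : Decidable (Compat α x) :=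
  inferInstanceAs (Decidable (_ ∨ _))

/-- The value of `f` if it is forced by what is known about the arguments. -/
def forced (f : BoolFn) (α β : Option Bool) : Option Bool :=
  if ∀ x y, Compat α x → Compat β y → f x y = true then some true
  else if ∀ x y, Compat α x → Compat β y → f x y = false then some false
  else none

/-- `f` can still depend on its first argument when the second one is known to be `β`. -/
def TransFst (f : BoolFn) (β : Option Bool) : Prop := ∃ y, Compat β y ∧ f false y ≠ f true y

/-- `f` can still depend on its second argument when the first one is known to be `α`. -/
def TransSnd (f : BoolFn) (α : Option Bool) : Prop := ∃ x, Compat α x ∧ f x false ≠ f x true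

instance (f : BoolFn) (β : Option Bool) : Decidable (TransFst f β) :=
  inferInstanceAs (Decidable (∃ _, _))

instance (f : BoolFn) (α : Option Bool) : Decidable (TransSnd f α) :=
  inferInstanceAs (Decidable (∃ _, _))

theorem forced_sound {f : BoolFn} {α β : Option Bool} {b : Bool} (h : forced f α β = some b)
    {x y : Bool} (hx : Compat α x) (hy : Compat β y) : f x y = b := by
  unfold forced at h
  split_ifs at h with h1 h2
  · cases h; exact h1 x y hx hy
  · cases h; exact h2 x y hx hy

/-- The law of a ternary value that is unknown with probability `p` and otherwise unbiased. -/
noncomputable def law (p : ℝ) : Option Bool → ℝ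
  | none => p
  | some _ => (1 - p) / 2

theorem law_nonneg {p : ℝ} (h0 : 0 ≤ p) (h1 : p ≤ 1) (α : Option Bool) : 0 ≤ law p α := by
  cases α
  · exact h0
  · exact div_nonneg (by linarith) (by norm_num)

theorem sum_law (p : ℝ) : ∑ α, law p α = 1 := by
  simp [Fintype.sum_option, law]
  ring

/-- The boolean function with the given table. -/
def ofTable (t : Bool × Bool × Bool × Bool) : BoolFn
  | false, false => t.1
  | false, true => t.2.1
  | true, false => t.2.2.1
  | true, true => t.2.2.2

/-- Boolean functions and their tables. -/
def tableEquiv : Bool × Bool × Bool × Bool ≃ BoolFn where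
  toFun := ofTable
  invFun f := (f false false, f false true, f true false, f true true)
  left_inv t := rfl
  right_inv f := by
    funext x y
    cases x <;> cases y <;> rfl

theorem sum_boolFn (φ : BoolFn → ℝ) : ∑ f, φ f =
    ∑ x, ∑ y, ∑ z, ∑ w, φ (ofTable (x, y, z, w)) := by
  rw [← tableEquiv.sum_comp φ]
  simp only [Fintype.sum_prod_type]
  rfl

theorem mass_classA (a : BoolFn → ℝ) : mass a classA =
    a (ofTable (false, false, false, false)) + a (ofTable (true, true, true, true)) := by
  have h : ∀ f, classA.indicator a f = if (∃ v, ∀ x y, f x y = v) then a f else 0 := by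
    intro f; simp [Set.indicator, classA]
  simp only [mass, h, sum_boolFn, Fintype.sum_bool]
  simp [ofTable]
  ring

theorem mass_classC (a : BoolFn → ℝ) : mass a classC =
    a (ofTable (false, true, true, false)) + a (ofTable (true, false, false, true)) := by
  have h : ∀ f, classC.indicator a f = if ¬ ((∃ u v, ∀ y, f u y = v) ∨
      (∃ u v, ∀ x, f x u = v)) then a f else 0 := by
    intro f; simp [Set.indicator, classC, Canalyzing]
  simp only [mass, h, sum_boolFn, Fintype.sum_bool]
  simp [ofTable]
  ring

theorem sum_law_forced (p : ℝ) (κ : Option Bool → ℝ) (t : Bool × Bool × Bool × Bool) :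
    ∑ α, ∑ β, law p α * law p β * κ (forced (ofTable t) α β) =
      match t with
      | (false, false, false, false) => κ (some false)
      | (true, true, true, true) => κ (some true)
      | (false, true, true, false) | (true, false, false, true) =>
        (2 * p - p ^ 2) * κ none + (1 - p) ^ 2 / 2 * (κ (some false) + κ (some true))
      | (false, false, true, true) | (true, true, false, false)
      | (false, true, false, true) | (true, false, true, false) =>
        p * κ none + (1 - p) / 2 * (κ (some false) + κ (some true))
      | (false, false, false, true) | (false, false, true, false)
      | (false, true, false, false) | (true, false, false, false) =>
        p * κ none + (1 - p ^ 2 - 2 * p * (1 - p) / 2 - (1 - p) ^ 2 / 4) * κ (some false) +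
          (1 - p) ^ 2 / 4 * κ (some true)
      | (true, true, true, false) | (true, true, false, true)
      | (true, false, true, true) | (false, true, true, true) =>
        p * κ none + (1 - p ^ 2 - 2 * p * (1 - p) / 2 - (1 - p) ^ 2 / 4) * κ (some true) +
          (1 - p) ^ 2 / 4 * κ (some false) := by
  obtain ⟨x, y, z, w⟩ := t
  cases x <;> cases y <;> cases z <;> cases w <;>
    simp [Fintype.sum_option, law, forced, Compat, ofTable] <;> ring

/-- The average number of arguments on which a random function can still depend. -/
theorem sum_law_trans (p : ℝ) (t : Bool × Bool × Bool × Bool) :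
    ∑ α, law p α * ((if TransFst (ofTable t) α then 1 else 0) +
        (if TransSnd (ofTable t) α then 1 else 0)) =
      match t with
      | (false, false, false, false) | (true, true, true, true) => (0 : ℝ)
      | (false, true, true, false) | (true, false, false, true) => 2
      | (false, false, true, true) | (true, true, false, false)
      | (false, true, false, true) | (true, false, true, false) => 1
      | (false, false, false, true) | (false, false, true, false)
      | (false, true, false, false) | (true, false, false, false)
      | (true, true, true, false) | (true, true, false, true)
      | (true, false, true, true) | (false, true, true, true) => 1 + p := by
  obtain ⟨x, y, z, w⟩ := t
  cases x <;> cases y <;> cases z <;> cases w <;>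
    simp [Fintype.sum_option, law, TransFst, TransSnd, Compat, ofTable] <;> ring

/-- One step of the recursion for the probability that a gate is not yet forced. -/
noncomputable def unforcedStep (a : BoolFn → ℝ) (p : ℝ) : ℝ :=
  p * (1 - mass a classA + mass a classC) - mass a classC * p ^ 2

/-- The family `law p` is closed under applying a random function to two independent arguments. The
output is unknown with probability 0 for constants, p for non-constant canalyzing functions and 2p -
p² for non-canalyzing ones. A forced output is unbiased automatically for functions of one argument
and for equivalence and exclusive or; for the remaining functions the bias cancels between f and its
negation. -/
theorem sum_law_unforcedStep {a : BoolFn → ℝ} (ha : ∑ f, a f = 1)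
    (ha_neg : ∀ f ∈ classA ∪ classB₂, a f = a (fun x y => !(f x y)))
    (p : ℝ) (κ : Option Bool → ℝ) :
    ∑ f, a f * ∑ α, ∑ β, law p α * law p β * κ (forced f α β) =
      ∑ γ, law (unforcedStep a p) γ * κ γ := by
  have hneg : ∀ t : Bool × Bool × Bool × Bool, ofTable t ∈ classA ∪ classB₂ →
      a (ofTable t) = a (ofTable (!t.1, !t.2.1, !t.2.2.1, !t.2.2.2)) := by
    intro t ht
    rw [ha_neg _ ht]
    congr 1
    funext x y
    cases x <;> cases y <;> rfl
  have h0 := hneg (false, false, false, false) (by simp [classA, ofTable])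
  have h1 := hneg (false, false, false, true)
    (by simp [classA, classB₂, Canalyzing, DependsFst, DependsSnd, ofTable])
  have h2 := hneg (false, false, true, false)
    (by simp [classA, classB₂, Canalyzing, DependsFst, DependsSnd, ofTable])
  have h3 := hneg (false, true, false, false)
    (by simp [classA, classB₂, Canalyzing, DependsFst, DependsSnd, ofTable])
  have h4 := hneg (true, false, false, false)
    (by simp [classA, classB₂, Canalyzing, DependsFst, DependsSnd, ofTable])
  rw [sum_boolFn] at ha ⊢
  simp only [sum_law_forced, unforcedStep, mass_classA, mass_classC]
  simp only [Fintype.sum_option, Fintype.sum_bool, law] at ha ⊢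
  simp only [Bool.not_true, Bool.not_false] at h0 h1 h2 h3 h4
  rw [h0, h1, h2, h3, h4] at ha ⊢
  -- The coefficient is the average of κ under `law p`, which is what the non-constant canalyzing
  -- functions contribute per unit of mass; only the constant and the non-canalyzing functions
  -- deviate from it.
  linear_combination (p * κ none + (1 - p) / 2 * (κ (some false) + κ (some true))) * ha

/-- A canalyzing function of both arguments transmits each one for exactly one value of the other:
on average 1 argument when the other values are known, and 2 when they are unknown, so 1 + p. The
other classes give 0, 1 and 2; replacing 1 by 1 + p where needed yields the bound. -/
theorem sum_trans_le {a : BoolFn → ℝ} (ha0 : ∀ f, 0 ≤ a f) (ha : ∑ f, a f = 1) {p : ℝ}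
    (hp : 0 ≤ p) :
    ∑ f, a f * ∑ α, law p α * ((if TransFst f α then 1 else 0) +
        (if TransSnd f α then 1 else 0)) ≤
      1 - mass a classA + mass a classC + p := by
  have h : ∀ t, 0 ≤ a (ofTable t) * p := fun t => mul_nonneg (ha0 _) hp
  rw [sum_boolFn] at ha ⊢
  simp only [sum_law_trans, mass_classA, mass_classC]
  simp only [Fintype.sum_bool] at ha ⊢
  have hp' := congrArg (· * p) ha
  simp only [add_mul, one_mul] at hp'
  linarith [h (false, false, false, false), h (true, true, true, true),
    h (false, true, true, false), h (true, false, false, true),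
    h (false, false, true, true), h (true, true, false, false),
    h (false, true, false, true), h (true, false, true, false)]

theorem mass_classA_add_classC_le {a : BoolFn → ℝ} (ha0 : ∀ f, 0 ≤ a f) (ha : ∑ f, a f = 1) :
    mass a classA + mass a classC ≤ 1 := by
  rw [sum_boolFn] at ha
  simp only [mass_classA, mass_classC]
  simp only [Fintype.sum_bool] at ha
  have h : ∀ t, 0 ≤ a (ofTable t) := fun t => ha0 _
  linarith [h (false, false, true, true), h (true, true, false, false),
    h (false, true, false, true), h (true, false, true, false),
    h (false, false, false, true), h (false, false, true, false),
    h (false, true, false, false), h (true, false, false, false),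
    h (true, true, true, false), h (true, true, false, true),
    h (true, false, true, true), h (false, true, true, true)]

theorem mass_nonneg {a : BoolFn → ℝ} (ha0 : ∀ f, 0 ≤ a f) (S : Set BoolFn) : 0 ≤ mass a S :=
  Finset.sum_nonneg fun f _ => Set.indicator_nonneg (fun f _ => ha0 f) f

/-- The probability that a gate is not forced by its predecessors up to the given depth. -/
noncomputable def unforced (a : BoolFn → ℝ) : ℕ → ℝ
  | 0 => 1
  | m + 1 => unforcedStep a (unforced a m)

/-- Dropping the term -cp² from the recursion leaves a geometric bound with ratio 1 - a + c.
Nonnegativity comes from a + c ≤ 1. -/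
theorem unforced_mem {a : BoolFn → ℝ} (ha0 : ∀ f, 0 ≤ a f) (ha : ∑ f, a f = 1)
    (hac : mass a classC < mass a classA) (m : ℕ) :
    0 ≤ unforced a m ∧ unforced a m ≤ (1 - mass a classA + mass a classC) ^ m := by
  have h1 := mass_classA_add_classC_le ha0 ha
  have h2 := mass_nonneg ha0 classC
  induction m with
  | zero => simp [unforced]
  | succ m ih =>
    have hle : unforced a m ≤ 1 := ih.2.trans (pow_le_one₀ (by linarith) (by linarith))
    constructor
    · have : unforced a (m + 1) = unforced a m *
          (1 - mass a classA + mass a classC * (1 - unforced a m)) := by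
        simp only [unforced, unforcedStep]; ring
      rw [this]
      have := mul_nonneg h2 (sub_nonneg.2 hle)
      exact mul_nonneg ih.1 (by linarith)
    · have h3 : unforced a (m + 1) ≤ unforced a m * (1 - mass a classA + mass a classC) :=
        sub_le_self _ (mul_nonneg h2 (sq_nonneg _))
      rw [pow_succ]
      exact h3.trans (mul_le_mul_of_nonneg_right ih.2 (by linarith))

theorem unforced_le_one {a : BoolFn → ℝ} (ha0 : ∀ f, 0 ≤ a f) (ha : ∑ f, a f = 1)
    (hac : mass a classC < mass a classA) (m : ℕ) : unforced a m ≤ 1 :=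
  (unforced_mem ha0 ha hac m).2.trans (pow_le_one₀
    (by linarith [mass_classA_add_classC_le ha0 ha, mass_nonneg ha0 classC]) (by linarith))

theorem exists_unforced_lt {a : BoolFn → ℝ} (ha0 : ∀ f, 0 ≤ a f) (ha : ∑ f, a f = 1)
    (hac : mass a classC < mass a classA) {ε : ℝ} (hε : 0 < ε) : ∃ m, unforced a m < ε := by
  obtain ⟨m, hm⟩ := exists_pow_lt_of_lt_one hε
    (show 1 - mass a classA + mass a classC < 1 by linarith)
  exact ⟨m, (unforced_mem ha0 ha hac m).2.trans_lt hm⟩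

end Ternary

/-! ### Backward exploration of predecessors and transmitting paths -/

section Exploration

variable {n : ℕ}

/-- Explore the predecessors of `j` up to depth `m`, keeping away from `S`. The continuation `K`
receives what is then known about the value of `j` and the set of revealed gates. If a gate
is met twice, or one of `S` is met, the result is `1`. -/
def explore (B : Fin n → Gate n) : ℕ → Finset (Fin n) → Fin n →
    (Option Bool → Finset (Fin n) → ℝ) → ℝ
  | 0, _, _, K => K none ∅
  | m + 1, S, j, K =>
    if Hits (B j).1 (insert j S) then 1 else
      explore B m (insert (B j).1.1.2 (insert j S)) (B j).1.1.1 fun α W =>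
        explore B m (insert j S ∪ W) (B j).1.1.2 fun β W' =>
          K (forced (B j).2 α β) (insert j (W ∪ W'))

/-- The sum over the two inputs `p` of `v` of the number of ways to continue to `p`, given that
the other input was explored up to depth `m`. -/
def branch (B : Fin n → Gate n) (m : ℕ) (R : Finset (Fin n)) (v : Fin n) (g : Gate n)
    (N : Finset (Fin n) → Fin n → ℝ) : ℝ :=
  if Hits g.1 (insert v R) then 1 else
    explore B m (insert g.1.1.1 (insert v R)) g.1.1.2 (fun α W =>
      if TransFst g.2 α then N (insert v R ∪ W) g.1.1.1 else 0) +
    explore B m (insert g.1.1.2 (insert v R)) g.1.1.1 (fun α W =>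
      if TransSnd g.2 α then N (insert v R ∪ W) g.1.1.2 else 0)

/-- The number of backward paths of length `l` from `v` along which a change of value can be
transmitted, where a path that meets a revealed gate ends there and is counted. -/
def paths (B : Fin n → Gate n) (m : ℕ) : ℕ → Finset (Fin n) → Fin n → ℝ
  | 0, _, _ => 1
  | l + 1, R, v => branch B m R v (B v) (paths B m l)

/-- Away from collisions the search reads only gates outside `S`. This is the independence that lets
`expect_reveal` be applied to one gate after another. The continuation need only agree on sets `W`
disjoint from `S`, as the revealed gates always are. -/
theorem explore_congr {B B' : Fin n → Gate n} {U : Finset (Fin n)} (h : ∀ i ∉ U, B i = B' i)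
    (m : ℕ) {S : Finset (Fin n)} {j : Fin n} {K K' : Option Bool → Finset (Fin n) → ℝ}
    (hU : U ⊆ S) (hj : j ∉ S) (hK : ∀ α W, Disjoint W S → K α W = K' α W) :
    explore B m S j K = explore B' m S j K' := by
  induction m generalizing S j K K' with
  | zero => exact hK _ _ (Finset.disjoint_empty_left _)
  | succ m ih =>
    simp only [explore]
    rw [← h j (fun hh => hj (hU hh))]
    split_ifs with hc
    · rfl
    · simp only [Hits, not_or] at hc
      have hne : (B j).1.1.1 ≠ (B j).1.1.2 := (B j).1.2.ne
      refine ih (hU.trans ?_) ?_ fun α W hW => ?_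
      · exact (Finset.subset_insert _ _).trans (Finset.subset_insert _ _)
      · simp only [Finset.mem_insert, not_or] at hc ⊢
        exact ⟨hne, hc.1⟩
      · rw [Finset.disjoint_insert_right, Finset.disjoint_insert_right] at hW
        refine ih (hU.trans ?_) ?_ fun β W' hW' => ?_
        · exact (Finset.subset_insert _ _).trans Finset.subset_union_left
        · rw [Finset.mem_union, not_or]
          exact ⟨hc.2, hW.1⟩
        · rw [Finset.disjoint_union_right, Finset.disjoint_insert_right] at hW'
          refine hK _ _ ?_
          rw [Finset.disjoint_insert_left, Finset.disjoint_union_left]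
          exact ⟨hj, hW.2.2, hW'.1.2⟩

theorem branch_congr {B B' : Fin n → Gate n} {U : Finset (Fin n)} (h : ∀ i ∉ U, B i = B' i)
    (m : ℕ) {R : Finset (Fin n)} {v : Fin n} (g : Gate n) {N N' : Finset (Fin n) → Fin n → ℝ}
    (hU : U ⊆ insert v R) (hN : ∀ R' p, insert v R ⊆ R' → p ∉ R' → N R' p = N' R' p) :
    branch B m R v g N = branch B' m R v g N' := by
  simp only [branch]
  split_ifs with hc
  · rfl
  · simp only [Hits, not_or] at hc
    have hne : g.1.1.1 ≠ g.1.1.2 := g.1.2.ne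
    congr 1
    · refine explore_congr h m (hU.trans (Finset.subset_insert _ _)) ?_ fun α W hW => ?_
      · rw [Finset.mem_insert, not_or]
        exact ⟨hne.symm, hc.2⟩
      · rw [Finset.disjoint_insert_right] at hW
        rw [hN _ _ Finset.subset_union_left]
        rw [Finset.mem_union, not_or]
        exact ⟨hc.1, hW.1⟩
    · refine explore_congr h m (hU.trans (Finset.subset_insert _ _)) ?_ fun α W hW => ?_
      · rw [Finset.mem_insert, not_or]
        exact ⟨hne, hc.1⟩
      · rw [Finset.disjoint_insert_right] at hW
        rw [hN _ _ Finset.subset_union_left]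
        rw [Finset.mem_union, not_or]
        exact ⟨hc.2, hW.1⟩

theorem paths_congr {B B' : Fin n → Gate n} {U : Finset (Fin n)} (h : ∀ i ∉ U, B i = B' i)
    (m l : ℕ) {R : Finset (Fin n)} {v : Fin n} (hU : U ⊆ R) (hv : v ∉ R) :
    paths B m l R v = paths B' m l R v := by
  induction l generalizing R v with
  | zero => rfl
  | succ l ih =>
    simp only [paths]
    rw [← h v (fun hh => hv (hU hh))]
    exact branch_congr h m _ (hU.trans (Finset.subset_insert _ _)) fun R' p hR hp =>
      ih ((hU.trans (Finset.subset_insert _ _)).trans hR) hp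

end Exploration

/-! ### Frozen gates and what the exploration certifies -/

section Frozen

variable {n : ℕ}

/-- The automaton with the given gates. -/
def ofGates (B : Fin n → Gate n) : Automaton n := (fun i => (B i).1, fun i => (B i).2)

/-- The gate `i` eventually has the value `b`, whatever the initial state. -/
def FrozenTo (B : Fin n → Gate n) (i : Fin n) (b : Bool) : Prop :=
  ∃ T, ∀ x t, T ≤ t → stateAt (ofGates B) x t i = b

/-- The gate `i` eventually has a value that does not depend on the initial state. -/
def Frozen (B : Fin n → Gate n) (i : Fin n) : Prop := ∃ b, FrozenTo B i b

theorem stateAt_succ (B : Fin n → Gate n) (x : Fin n → Bool) (t : ℕ) (i : Fin n) :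
    stateAt (ofGates B) x (t + 1) i =
      (B i).2 (stateAt (ofGates B) x t (B i).1.1.1) (stateAt (ofGates B) x t (B i).1.1.2) := by
  simp only [stateAt, Function.iterate_succ_apply']
  rfl

theorem frozenTo_of_eventually {B : Fin n → Gate n} {i : Fin n} {b : Bool} {T : ℕ}
    (h : ∀ x t, T ≤ t → (B i).2 (stateAt (ofGates B) x t (B i).1.1.1)
      (stateAt (ofGates B) x t (B i).1.1.2) = b) : FrozenTo B i b := by
  refine ⟨T + 1, fun x t ht => ?_⟩
  obtain ⟨t, rfl⟩ : ∃ s, t = s + 1 := ⟨t - 1, by omega⟩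
  rw [stateAt_succ]
  exact h x t (by omega)

/-- What is known about the value of gate `i` is eventually true. -/
def Sound (B : Fin n → Gate n) (i : Fin n) (α : Option Bool) : Prop :=
  ∀ b, α = some b → FrozenTo B i b

theorem Sound.exists_compat {B : Fin n → Gate n} {i : Fin n} {α : Option Bool}
    (h : Sound B i α) : ∃ T, ∀ x t, T ≤ t → Compat α (stateAt (ofGates B) x t i) := by
  cases α with
  | none => exact ⟨0, fun _ _ _ => Or.inl rfl⟩
  | some b =>
    obtain ⟨T, hT⟩ := h b rfl
    exact ⟨T, fun x t ht => Or.inr (by rw [hT x t ht])⟩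

theorem Sound.forced {B : Fin n → Gate n} {i : Fin n} {α β : Option Bool}
    (hα : Sound B (B i).1.1.1 α) (hβ : Sound B (B i).1.1.2 β) :
    Sound B i (forced (B i).2 α β) := by
  intro b hb
  obtain ⟨T, hT⟩ := hα.exists_compat
  obtain ⟨T', hT'⟩ := hβ.exists_compat
  exact frozenTo_of_eventually (T := max T T') fun x t ht =>
    forced_sound hb (hT x t (le_trans (le_max_left _ _) ht))
      (hT' x t (le_trans (le_max_right _ _) ht))

/-- Every report of the search is sound, and a collision returns 1, so stopping there never loses
the lower bound. -/
theorem one_le_explore (B : Fin n → Gate n) (m : ℕ) {S : Finset (Fin n)} {j : Fin n}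
    {K : Option Bool → Finset (Fin n) → ℝ} (hK : ∀ α W, Sound B j α → 1 ≤ K α W) :
    1 ≤ explore B m S j K := by
  induction m generalizing S j K with
  | zero => exact hK _ _ (fun b hb => by cases hb)
  | succ m ih =>
    simp only [explore]
    split_ifs
    · exact le_rfl
    · exact ih fun α W hα => ih fun β W' hβ => hK _ _ (hα.forced hβ)

theorem explore_nonneg (B : Fin n → Gate n) (m : ℕ) {S : Finset (Fin n)} {j : Fin n}
    {K : Option Bool → Finset (Fin n) → ℝ} (hK : ∀ α W, 0 ≤ K α W) :
    0 ≤ explore B m S j K := by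
  induction m generalizing S j K with
  | zero => exact hK _ _
  | succ m ih =>
    simp only [explore]
    split_ifs
    · exact zero_le_one
    · exact ih fun α W => ih fun β W' => hK _ _

theorem paths_nonneg (B : Fin n → Gate n) (m l : ℕ) (R : Finset (Fin n)) (v : Fin n) :
    0 ≤ paths B m l R v := by
  induction l generalizing R v with
  | zero => exact zero_le_one
  | succ l ih =>
    simp only [paths, branch]
    split_ifs
    · exact zero_le_one
    · refine add_nonneg (explore_nonneg B m fun α W => ?_) (explore_nonneg B m fun α W => ?_) <;>
      · split_ifs
        · exact ih _ _
        · exact le_rfl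

/-- A gate that is not frozen has an input that is not frozen and can affect it. -/
theorem exists_input_not_frozen {B : Fin n → Gate n} {v : Fin n} (hv : ¬ Frozen B v) :
    (¬ Frozen B (B v).1.1.1 ∧ ∀ α, Sound B (B v).1.1.2 α → TransFst (B v).2 α) ∨
    (¬ Frozen B (B v).1.1.2 ∧ ∀ α, Sound B (B v).1.1.1 α → TransSnd (B v).2 α) := by
  by_contra hcon
  rw [not_or, not_and_or, not_and_or, not_not, not_not] at hcon
  obtain ⟨h1, h2⟩ := hcon
  apply hv
  -- a known value of one input that makes the gate independent of the other freezes the gate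
  have key1 : ∀ α, Sound B (B v).1.1.2 α → ¬ TransFst (B v).2 α → Frozen B (B v).1.1.2 →
      Frozen B v := by
    rintro α hα ht ⟨b, hb⟩
    have hc : Compat α b := by
      obtain ⟨T, hT⟩ := hα.exists_compat
      obtain ⟨T', hT'⟩ := hb
      have := hT (fun _ => false) (max T T') (le_max_left _ _)
      rwa [hT' _ _ (le_max_right _ _)] at this
    obtain ⟨T, hT⟩ := hb
    refine ⟨(B v).2 false b, frozenTo_of_eventually (T := T) fun x t ht' => ?_⟩
    rw [hT x t ht']
    have : (B v).2 false b = (B v).2 true b := by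
      by_contra hne
      exact ht ⟨b, hc, hne⟩
    cases stateAt (ofGates B) x t (B v).1.1.1
    · rfl
    · exact this.symm
  have key2 : ∀ α, Sound B (B v).1.1.1 α → ¬ TransSnd (B v).2 α → Frozen B (B v).1.1.1 →
      Frozen B v := by
    rintro α hα ht ⟨b, hb⟩
    have hc : Compat α b := by
      obtain ⟨T, hT⟩ := hα.exists_compat
      obtain ⟨T', hT'⟩ := hb
      have := hT (fun _ => false) (max T T') (le_max_left _ _)
      rwa [hT' _ _ (le_max_right _ _)] at this
    obtain ⟨T, hT⟩ := hb
    refine ⟨(B v).2 b false, frozenTo_of_eventually (T := T) fun x t ht' => ?_⟩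
    rw [hT x t ht']
    have : (B v).2 b false = (B v).2 b true := by
      by_contra hne
      exact ht ⟨b, hc, hne⟩
    cases stateAt (ofGates B) x t (B v).1.1.2
    · rfl
    · exact this.symm
  have both : Frozen B (B v).1.1.1 → Frozen B (B v).1.1.2 → Frozen B v := by
    rintro ⟨b, T, hT⟩ ⟨b', T', hT'⟩
    refine ⟨(B v).2 b b', frozenTo_of_eventually (T := max T T') fun x t ht => ?_⟩
    rw [hT x t (le_trans (le_max_left _ _) ht), hT' x t (le_trans (le_max_right _ _) ht)]
  by_cases hp : Frozen B (B v).1.1.1 <;> by_cases hq : Frozen B (B v).1.1.2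
  · exact both hp hq
  · obtain ⟨α, hα, ht⟩ : ∃ α, Sound B (B v).1.1.1 α ∧ ¬ TransSnd (B v).2 α := by
      simpa using h2.resolve_left hq
    exact key2 α hα ht hp
  · obtain ⟨α, hα, ht⟩ : ∃ α, Sound B (B v).1.1.2 α ∧ ¬ TransFst (B v).2 α := by
      simpa using h1.resolve_left hp
    exact key1 α hα ht hq
  · obtain ⟨α, hα, ht⟩ : ∃ α, Sound B (B v).1.1.2 α ∧ ¬ TransFst (B v).2 α := by
      simpa using h1.resolve_left hp
    obtain ⟨β, hβ, ht'⟩ : ∃ α, Sound B (B v).1.1.1 α ∧ ¬ TransSnd (B v).2 α := by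
      simpa using h2.resolve_left hq
    -- Sound information about a gate that is not frozen is void. So the function depends on neither
    -- argument and is constant, which freezes the gate after all.
    have hα0 : α = none := by
      cases α with
      | none => rfl
      | some b => exact absurd ⟨b, hα b rfl⟩ hq
    have hβ0 : β = none := by
      cases β with
      | none => rfl
      | some b => exact absurd ⟨b, hβ b rfl⟩ hp
    have e1 : ∀ y, (B v).2 false y = (B v).2 true y := fun y => by
      by_contra hne
      exact ht ⟨y, Or.inl hα0, hne⟩
    have e2 : ∀ x, (B v).2 x false = (B v).2 x true := fun x => by
      by_contra hne
      exact ht' ⟨x, Or.inl hβ0, hne⟩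
    refine ⟨(B v).2 false false, frozenTo_of_eventually (T := 0) fun x t _ => ?_⟩
    cases stateAt (ofGates B) x t (B v).1.1.1 <;> cases stateAt (ofGates B) x t (B v).1.1.2 <;>
      simp [e1, e2]

/-- Iterating `exists_input_not_frozen` yields a backward path that is counted, either to full
length or up to its first collision. -/
theorem one_le_paths {B : Fin n → Gate n} (m l : ℕ) {R : Finset (Fin n)} {v : Fin n}
    (hv : ¬ Frozen B v) : 1 ≤ paths B m l R v := by
  induction l generalizing R v with
  | zero => exact le_rfl
  | succ l ih =>
    have hnn : ∀ (P : Prop) [Decidable P] (R' : Finset (Fin n)) (p : Fin n),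
        0 ≤ if P then paths B m l R' p else 0 := by
      intro P _ R' p
      split_ifs
      · exact paths_nonneg _ _ _ _ _
      · exact le_rfl
    simp only [paths, branch]
    split_ifs
    · exact le_rfl
    · rcases exists_input_not_frozen hv with ⟨hp, ht⟩ | ⟨hq, ht⟩
      · refine le_add_of_le_of_nonneg (one_le_explore B m fun α W hα => ?_)
          (explore_nonneg B m fun α W => hnn _ _ _)
        rw [if_pos (ht α hα)]
        exact ih hp
      · refine le_add_of_nonneg_of_le (explore_nonneg B m fun α W => hnn _ _ _)
          (one_le_explore B m fun α W hα => ?_)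
        rw [if_pos (ht α hα)]
        exact ih hq

end Frozen

/-! ### State cycles and frozen gates -/

section Cycles

variable {n : ℕ}

theorem stateAt_add_mul {B : Automaton n} {x : Fin n → Bool} {t₀ d t : ℕ}
    (h : stateAt B x t₀ = stateAt B x (t₀ + d)) (ht : t₀ ≤ t) (k : ℕ) :
    stateAt B x (t + k * d) = stateAt B x t := by
  induction k with
  | zero => simp
  | succ k ih =>
    rw [← ih]
    have e : ∀ s, stateAt B x (t₀ + d + s) = stateAt B x (t₀ + s) := by
      intro s
      simp only [stateAt] at h ⊢
      rw [add_comm _ s, Function.iterate_add_apply, ← h, ← Function.iterate_add_apply, add_comm]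
    obtain ⟨s, rfl⟩ := Nat.exists_eq_add_of_le ht
    rw [show t₀ + s + (k + 1) * d = t₀ + d + (s + k * d) by ring, e, add_assoc]

theorem eq_of_mem_stateCycle {B : Fin n → Gate n} {x y : Fin n → Bool}
    (hy : y ∈ stateCycle (ofGates B) x) {i : Fin n} {b : Bool} (hb : FrozenTo B i b) :
    y i = b := by
  obtain ⟨t₀, t₁, ⟨hlt, heq, -⟩, t, ht, rfl⟩ := hy
  obtain ⟨T, hT⟩ := hb
  obtain ⟨d, rfl⟩ := Nat.exists_eq_add_of_le hlt.le
  have hd : 1 ≤ d := by omega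
  -- Since the period `d` is at least 1, going round the cycle `T` more times leads past time `T`
  -- without changing the state.
  rw [← stateAt_add_mul heq ht T]
  exact hT x _ (by nlinarith)

-- Two states of the cycle agree on all frozen gates, so restriction to the others is injective.
open Classical in
theorem ncard_stateCycle_le (B : Fin n → Gate n) (x : Fin n → Bool) :
    (stateCycle (ofGates B) x).ncard ≤ 2 ^ #{i | ¬ Frozen B i} := by
  have hinj : Set.InjOn (fun (y : Fin n → Bool) (i : {i // ¬ Frozen B i}) => y i)
      (stateCycle (ofGates B) x) := by
    intro y hy z hz h
    funext i
    by_cases hi : Frozen B i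
    · obtain ⟨b, hb⟩ := hi
      rw [eq_of_mem_stateCycle hy hb, eq_of_mem_stateCycle hz hb]
    · exact congrFun h ⟨i, hi⟩
  rw [← hinj.ncard_image]
  refine (Set.ncard_le_ncard (Set.subset_univ _)).trans (le_of_eq ?_)
  rw [Set.ncard_univ, Nat.card_eq_fintype_card, Fintype.card_fun, Fintype.card_bool,
    Fintype.card_subtype]

end Cycles

/-! ### Expected sizes and Markov's inequality -/

section Estimates

variable {a : BoolFn → ℝ}

/-- Up to an error O(|S|/n), the search behaves as on a tree and reports with law `law (unforced a
m)`. The second input is explored inside the continuation of the first, avoiding what was revealed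
there, so the two reports act as independent. A search of depth m reveals at most the 2^m - 1 inner
nodes of a binary tree, whence the size condition on `W`. -/
theorem exists_expect_explore_le (ha0 : ∀ f, 0 ≤ a f) (ha : ∑ f, a f = 1)
    (ha_neg : ∀ f ∈ classA ∪ classB₂, a f = a (fun x y => !(f x y)))
    (hac : mass a classC < mass a classA) (m : ℕ) :
    ∃ c : ℝ, 0 ≤ c ∧ ∀ n : ℕ, 2 ≤ n → ∀ (S : Finset (Fin n)) (j : Fin n), j ∉ S →
      ∀ (K : Option Bool → Finset (Fin n) → (Fin n → Gate n) → ℝ) (κ : Option Bool → ℝ),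
      (∀ γ, 0 ≤ κ γ) →
      (∀ α W, Disjoint W S → DependsOn (K α W) (W : Set (Fin n))ᶜ) →
      (∀ α W, Disjoint W S → #W + 1 ≤ 2 ^ m → expect (gateWeight a n) (K α W) ≤ κ α) →
      expect (gateWeight a n) (fun B => explore B m S j fun α W => K α W B) ≤
        c * (#S + 1) / n + ∑ γ, law (unforced a m) γ * κ γ := by
  induction m with
  | zero =>
    refine ⟨0, le_rfl, fun n hn S j hj K κ hκ hK hE => ?_⟩
    have := hE none ∅ (Finset.disjoint_empty_left _) (by simp)
    simpa [explore, Fintype.sum_option, law, unforced] using this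
  | succ m ih =>
    obtain ⟨c, hc, ih⟩ := ih
    -- The 2 pays for a collision at `j` itself. The first search avoids at most |S| + 2 gates,
    -- costing 3c; the second avoids at most |S| + 2^m, costing (1 + 2^m)c.
    refine ⟨2 + 3 * c + (1 + 2 ^ m) * c, by positivity, fun n hn S j hj K κ hκ hK hE => ?_⟩
    have hw := sum_gateWeight ha hn
    have hw0 := gateWeight_nonneg ha0 (n := n)
    have hp0 := (unforced_mem ha0 ha hac m).1
    have hp1 := unforced_le_one ha0 ha hac m
    have hlaw := law_nonneg hp0 hp1
    set p := unforced a m with hp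
    let Φ : Gate n → (Fin n → Gate n) → ℝ := fun g B =>
      if Hits g.1 (insert j S) then 1 else
        explore B m (insert g.1.1.2 (insert j S)) g.1.1.1 fun α W =>
          explore B m (insert j S ∪ W) g.1.1.2 fun β W' =>
            K (forced g.2 α β) (insert j (W ∪ W')) B
    have hdisj : ∀ {W W' : Finset (Fin n)}, Disjoint W S → Disjoint W' S →
        Disjoint (insert j (W ∪ W')) S := by
      intro W W' h h'
      rw [Finset.disjoint_insert_left, Finset.disjoint_union_left]
      exact ⟨hj, h, h'⟩
    have hΦ : ∀ g, DependsOn (Φ g) {j}ᶜ := by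
      intro g B B' hB
      have hB' : ∀ i ∉ ({j} : Finset (Fin n)), B i = B' i := fun i hi => hB i (by simpa using hi)
      simp only [Φ]
      split_ifs with hh
      · rfl
      · simp only [Hits, not_or] at hh
        refine explore_congr hB' m (by simp) ?_ fun α W hW => ?_
        · rw [Finset.mem_insert, not_or]
          exact ⟨g.1.2.ne, hh.1⟩
        · rw [Finset.disjoint_insert_right, Finset.disjoint_insert_right] at hW
          refine explore_congr hB' m (by simp) ?_ fun β W' hW' => ?_
          · rw [Finset.mem_union, not_or]
            exact ⟨hh.2, hW.1⟩
          · rw [Finset.disjoint_union_right, Finset.disjoint_insert_right] at hW'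
            refine hK _ _ (hdisj hW.2.2 hW'.1.2) fun i hi => hB i ?_
            rintro rfl
            exact hi (by simp)
    have hs : (#(insert j S) : ℝ) ≤ #S + 1 := by exact_mod_cast Finset.card_insert_le _ _
    have hbound : ∀ g : Gate n, expect (gateWeight a n) (Φ g) ≤
        (if Hits g.1 (insert j S) then 1 else 0) +
          ((3 * c + (1 + 2 ^ m) * c) * (#S + 1) / n +
          ∑ α, ∑ β, law p α * law p β * κ (forced g.2 α β)) := by
      intro g
      have hnn : 0 ≤ ∑ α, ∑ β, law p α * law p β * κ (forced g.2 α β) :=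
        Finset.sum_nonneg fun α _ => Finset.sum_nonneg fun β _ =>
          mul_nonneg (mul_nonneg (hlaw _) (hlaw _)) (hκ _)
      by_cases hh : Hits g.1 (insert j S)
      · simp only [Φ, if_pos hh]
        rw [expect_const hw]
        have : 0 ≤ (3 * c + (1 + 2 ^ m) * c) * (#S + 1) / n := by positivity
        linarith
      · simp only [Φ, if_neg hh, zero_add]
        simp only [Hits, not_or] at hh
        have h1 := ih n hn (insert g.1.1.2 (insert j S)) g.1.1.1 (by
            rw [Finset.mem_insert, not_or]
            exact ⟨g.1.2.ne, hh.1⟩)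
          (fun α W B => explore B m (insert j S ∪ W) g.1.1.2 fun β W' =>
            K (forced g.2 α β) (insert j (W ∪ W')) B)
          (fun α => c * ((1 + 2 ^ m) * (#S + 1)) / n + ∑ β, law p β * κ (forced g.2 α β))
          (fun α => add_nonneg (by positivity)
            (Finset.sum_nonneg fun β _ => mul_nonneg (hlaw _) (hκ _)))
          (fun α W hW => by
            rw [Finset.disjoint_insert_right, Finset.disjoint_insert_right] at hW
            intro B B' hB
            refine explore_congr (U := W) (fun i hi => hB i (by simpa using hi)) m
              Finset.subset_union_right ?_ fun β W' hW' => ?_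
            · rw [Finset.mem_union, not_or]
              exact ⟨hh.2, hW.1⟩
            · rw [Finset.disjoint_union_right, Finset.disjoint_insert_right] at hW'
              refine hK _ _ (hdisj hW.2.2 hW'.1.2) fun i hi => hB i fun hi' => hi ?_
              simp only [Finset.coe_insert, Finset.coe_union, Set.mem_insert_iff, Set.mem_union]
              exact Or.inr (Or.inl hi'))
          (fun α W hW hWc => by
            rw [Finset.disjoint_insert_right, Finset.disjoint_insert_right] at hW
            refine (ih n hn (insert j S ∪ W) g.1.1.2 (by
                rw [Finset.mem_union, not_or]
                exact ⟨hh.2, hW.1⟩)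
              (fun β W' => K (forced g.2 α β) (insert j (W ∪ W')))
              (fun β => κ (forced g.2 α β)) (fun β => hκ _) (fun β W' hW' => ?_)
              (fun β W' hW' hWc' => ?_)).trans ?_
            · rw [Finset.disjoint_union_right, Finset.disjoint_insert_right] at hW'
              intro B B' hB
              refine hK _ _ (hdisj hW.2.2 hW'.1.2) fun i hi => hB i fun hi' => hi ?_
              simp only [Finset.coe_insert, Finset.coe_union, Set.mem_insert_iff, Set.mem_union]
              exact Or.inr (Or.inr hi')
            · rw [Finset.disjoint_union_right, Finset.disjoint_insert_right] at hW'
              refine hE _ _ (hdisj hW.2.2 hW'.1.2) ?_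
              have e1 := Finset.card_insert_le j (W ∪ W')
              have e2 := Finset.card_union_le W W'
              rw [pow_succ]
              omega
            · have e1 : (#(insert j S ∪ W) : ℝ) ≤ #(insert j S) + #W := by
                exact_mod_cast Finset.card_union_le _ _
              have e2 : (#W : ℝ) + 1 ≤ 2 ^ m := by exact_mod_cast hWc
              have e3 : (0 : ℝ) ≤ #S * 2 ^ m := by positivity
              gcongr
              linarith)
        refine h1.trans ?_
        have e1 : (#(insert g.1.1.2 (insert j S)) : ℝ) ≤ #(insert j S) + 1 := by
          exact_mod_cast Finset.card_insert_le _ _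
        have e2 : c * (#(insert g.1.1.2 (insert j S)) + 1) / n ≤ c * (3 * (#S + 1)) / n := by
          have : (0 : ℝ) ≤ #S := by positivity
          gcongr
          linarith
        refine (add_le_add_left e2 _).trans (le_of_eq ?_)
        simp only [mul_add, Finset.sum_add_distrib, ← Finset.sum_mul, sum_law]
        simp only [Finset.mul_sum, mul_assoc]
        ring
    have hrev := expect_reveal hw j Φ hΦ
    have hexp : expect (gateWeight a n) (fun B => explore B (m + 1) S j fun α W => K α W B) =
        expect (gateWeight a n) (fun B => Φ (B j) B) := rfl
    rw [hexp, hrev]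
    calc ∑ g, gateWeight a n g * expect (gateWeight a n) (Φ g)
        ≤ ∑ g, gateWeight a n g * ((if Hits g.1 (insert j S) then 1 else 0) +
          ((3 * c + (1 + 2 ^ m) * c) * (#S + 1) / n +
          ∑ α, ∑ β, law p α * law p β * κ (forced g.2 α β))) :=
          Finset.sum_le_sum fun g _ => mul_le_mul_of_nonneg_left (hbound g) (hw0 g)
      _ = ∑ g, gateWeight a n g * (if Hits g.1 (insert j S) then 1 else 0) +
          ((3 * c + (1 + 2 ^ m) * c) * (#S + 1) / n +
          ∑ γ, law (unforced a (m + 1)) γ * κ γ) := by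
          have h := sum_law_unforcedStep ha ha_neg p κ
          have h' := sum_gateWeight_mul (a := a) hn
            (fun f => ∑ α, ∑ β, law p α * law p β * κ (forced f α β))
          simp only [mul_add, Finset.sum_add_distrib, ← Finset.sum_mul, hw, one_mul]
          rw [h', h]
          rfl
      _ ≤ 2 * (#S + 1) / n + ((3 * c + (1 + 2 ^ m) * c) * (#S + 1) / n +
          ∑ γ, law (unforced a (m + 1)) γ * κ γ) := by
          have h := sum_gateWeight_hits_le ha hn (insert j S)
          have h' : 2 * (#(insert j S) : ℝ) / n ≤ 2 * (#S + 1) / n := by gcongr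
          linarith
      _ = _ := by ring

/-- Induction on the length: reveal `v`, explore one input to see whether the other transmits, and
continue there. Each level multiplies the mean by at most μ, so the collision errors sum like a
geometric series. -/
theorem exists_expect_paths_le (ha0 : ∀ f, 0 ≤ a f) (ha : ∑ f, a f = 1)
    (ha_neg : ∀ f ∈ classA ∪ classB₂, a f = a (fun x y => !(f x y)))
    (hac : mass a classC < mass a classA) :
    ∃ (m : ℕ) (μ α β : ℝ), 0 ≤ μ ∧ μ < 1 ∧ 0 ≤ α ∧ 0 ≤ β ∧ ∀ n : ℕ, 2 ≤ n →
      ∀ (l : ℕ) (R : Finset (Fin n)) (v : Fin n), v ∉ R →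
        expect (gateWeight a n) (fun B => paths B m l R v) ≤ μ ^ l + (α * #R + β) / n := by
  obtain ⟨m, hm⟩ := exists_unforced_lt ha0 ha hac
    (show 0 < mass a classA - mass a classC by linarith)
  obtain ⟨c, hc, hexp⟩ := exists_expect_explore_le ha0 ha ha_neg hac m
  have hp0 := (unforced_mem ha0 ha hac m).1
  have hp1 := unforced_le_one ha0 ha hac m
  have hlaw := law_nonneg hp0 hp1
  set p := unforced a m with hp
  obtain ⟨μ, hμ⟩ : ∃ μ, μ = 1 - mass a classA + mass a classC + p := ⟨_, rfl⟩
  have hμ0 : 0 ≤ μ := by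
    linarith [mass_classA_add_classC_le ha0 ha, mass_nonneg ha0 classC]
  have hμ1 : 0 < 1 - μ := by linarith
  -- `α` and `β` are the fixed points of the error recursion in the induction step, recorded in
  -- `hα'` and `hβ'`; they exist because μ < 1.
  obtain ⟨α, hα⟩ : ∃ α, α = (2 + 6 * c) / (1 - μ) := ⟨_, rfl⟩
  obtain ⟨β, hβ⟩ : ∃ β, β = (2 + 6 * c + μ * α * 2 ^ m) / (1 - μ) := ⟨_, rfl⟩
  have hα0 : 0 ≤ α := by rw [hα]; positivity
  have hβ0 : 0 ≤ β := by rw [hβ]; positivity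
  have hα' : 2 + 6 * c + μ * α = α := by
    have := div_mul_cancel₀ (2 + 6 * c) hμ1.ne'
    rw [← hα] at this
    linarith
  have hβ' : 2 + 6 * c + μ * α * 2 ^ m + μ * β = β := by
    have := div_mul_cancel₀ (2 + 6 * c + μ * α * 2 ^ m) hμ1.ne'
    rw [← hβ] at this
    linarith
  refine ⟨m, μ, α, β, hμ0, by linarith, hα0, hβ0, fun n hn l => ?_⟩
  have hw := sum_gateWeight ha hn
  have hw0 := gateWeight_nonneg ha0 (n := n)
  induction l with
  | zero =>
    intro R v hv
    simp only [paths, pow_zero]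
    rw [expect_const hw]
    have : 0 ≤ (α * #R + β) / n := by positivity
    linarith
  | succ l ih =>
    intro R v hv
    let Φ : Gate n → (Fin n → Gate n) → ℝ := fun g B => branch B m R v g (paths B m l)
    -- The induction hypothesis for a continuation: besides `R`, at most 2^m gates are revealed,
    -- namely `v` and at most 2^m - 1 in the search.
    obtain ⟨H, hH⟩ : ∃ H, H = μ ^ l + (α * (#R + 2 ^ m) + β) / n := ⟨_, rfl⟩
    have hH0 : 0 ≤ H := by rw [hH]; positivity
    have hs : (#(insert v R) : ℝ) ≤ #R + 1 := by exact_mod_cast Finset.card_insert_le _ _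
    have hΦ : ∀ g, DependsOn (Φ g) {v}ᶜ := by
      intro g B B' hB
      have hB' : ∀ i ∉ ({v} : Finset (Fin n)), B i = B' i := fun i hi => hB i (by simpa using hi)
      exact branch_congr hB' m g (by simp) fun R' q hR hq =>
        paths_congr hB' m l ((by simp : {v} ⊆ insert v R).trans hR) hq
    -- exploring the input `q` and continuing to the input `o`
    have hone : ∀ (P : Option Bool → Prop) [DecidablePred P] (o q : Fin n), o ≠ q →
        o ∉ insert v R → q ∉ insert v R →
        expect (gateWeight a n) (fun B => explore B m (insert o (insert v R)) q fun γ W =>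
          if P γ then paths B m l (insert v R ∪ W) o else 0) ≤
        c * (3 * (#R + 1)) / n + ∑ γ, law p γ * (if P γ then 1 else 0) * H := by
      intro P _ o q hne ho hq
      refine (hexp n hn (insert o (insert v R)) q (by
          rw [Finset.mem_insert, not_or]
          exact ⟨hne.symm, hq⟩)
        (fun γ W B => if P γ then paths B m l (insert v R ∪ W) o else 0)
        (fun γ => (if P γ then 1 else 0) * H) (fun γ => ?_) (fun γ W hW => ?_)
        (fun γ W hW hWc => ?_)).trans ?_
      · split_ifs <;> simp [hH0]
      · rw [Finset.disjoint_insert_right] at hW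
        intro B B' hB
        simp only
        split_ifs
        · refine paths_congr (U := W) (fun i hi => hB i (by simpa using hi)) m l
            Finset.subset_union_right ?_
          rw [Finset.mem_union, not_or]
          exact ⟨ho, hW.1⟩
        · rfl
      · rw [Finset.disjoint_insert_right] at hW
        split_ifs
        · rw [one_mul, hH]
          refine (ih (insert v R ∪ W) o (by
            rw [Finset.mem_union, not_or]
            exact ⟨ho, hW.1⟩)).trans ?_
          have e1 : (#(insert v R ∪ W) : ℝ) ≤ #(insert v R) + #W := by
            exact_mod_cast Finset.card_union_le _ _
          have e2 : (#W : ℝ) + 1 ≤ 2 ^ m := by exact_mod_cast hWc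
          gcongr
          linarith
        · rw [zero_mul, expect_const hw]
      · have e1 : (#(insert o (insert v R)) : ℝ) ≤ #(insert v R) + 1 := by
          exact_mod_cast Finset.card_insert_le _ _
        have e2 : (0 : ℝ) ≤ #R := by positivity
        simp only [mul_assoc]
        gcongr
        linarith
    have hbound : ∀ g : Gate n, expect (gateWeight a n) (Φ g) ≤
        (if Hits g.1 (insert v R) then 1 else 0) + (6 * c * (#R + 1) / n +
          (∑ γ, law p γ * ((if TransFst g.2 γ then 1 else 0) +
            (if TransSnd g.2 γ then 1 else 0))) * H) := by
      intro g
      by_cases hh : Hits g.1 (insert v R)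
      · simp only [Φ, branch, if_pos hh]
        rw [expect_const hw]
        have h1 : 0 ≤ 6 * c * (#R + 1) / n := by positivity
        have h2 : 0 ≤ (∑ γ, law p γ * ((if TransFst g.2 γ then 1 else 0) +
            (if TransSnd g.2 γ then 1 else 0))) * H :=
          mul_nonneg (Finset.sum_nonneg fun γ _ => mul_nonneg (hlaw γ)
            (by split_ifs <;> norm_num)) hH0
        linarith
      · simp only [Φ, branch, if_neg hh, zero_add]
        simp only [Hits, not_or] at hh
        rw [expect_add]
        refine (add_le_add (hone (TransFst g.2) _ _ g.1.2.ne hh.1 hh.2)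
          (hone (TransSnd g.2) _ _ g.1.2.ne' hh.2 hh.1)).trans (le_of_eq ?_)
        simp only [mul_add, add_mul, Finset.sum_add_distrib, Finset.sum_mul]
        ring
    have hrev := expect_reveal hw v Φ hΦ
    have hexp' : expect (gateWeight a n) (fun B => paths B m (l + 1) R v) =
        expect (gateWeight a n) (fun B => Φ (B v) B) := rfl
    rw [hexp', hrev]
    calc ∑ g, gateWeight a n g * expect (gateWeight a n) (Φ g)
        ≤ ∑ g, gateWeight a n g * ((if Hits g.1 (insert v R) then 1 else 0) +
          (6 * c * (#R + 1) / n + (∑ γ, law p γ * ((if TransFst g.2 γ then 1 else 0) +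
            (if TransSnd g.2 γ then 1 else 0))) * H)) :=
          Finset.sum_le_sum fun g _ => mul_le_mul_of_nonneg_left (hbound g) (hw0 g)
      _ = ∑ g, gateWeight a n g * (if Hits g.1 (insert v R) then 1 else 0) +
          (6 * c * (#R + 1) / n + (∑ f, a f * ∑ γ, law p γ * ((if TransFst f γ then 1 else 0) +
            (if TransSnd f γ then 1 else 0))) * H) := by
          rw [← sum_gateWeight_mul (a := a) hn]
          simp only [mul_add, Finset.sum_add_distrib, ← Finset.sum_mul, hw, one_mul, add_mul,
            mul_assoc]
          simp only [← mul_assoc, ← Finset.sum_mul]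
      _ ≤ 2 * (#R + 1) / n + (6 * c * (#R + 1) / n + μ * H) := by
          have h := sum_gateWeight_hits_le ha hn (insert v R)
          have h' : 2 * (#(insert v R) : ℝ) / n ≤ 2 * (#R + 1) / n := by gcongr
          have h'' := mul_le_mul_of_nonneg_right (sum_trans_le ha0 ha hp0) hH0
          rw [← hμ] at h''
          linarith
      _ = μ ^ (l + 1) + ((2 + 6 * c + μ * α) * #R +
            (2 + 6 * c + μ * α * 2 ^ m + μ * β)) / n := by
          rw [hH]; ring
      _ = _ := by rw [hα', hβ']

theorem pr_eq_expect (a : BoolFn → ℝ) (n : ℕ) (P : Automaton n → Prop) [DecidablePred P] :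
    pr a n P = expect (gateWeight a n) (fun B => if P (ofGates B) then 1 else 0) := by
  rw [pr, expect, ← (Equiv.arrowProdEquivProdArrow (Fin n) (fun _ => InputPair n)
    (fun _ => BoolFn)).sum_comp]
  refine Finset.sum_congr rfl fun B _ => ?_
  rw [Set.indicator_apply, mul_ite, mul_one, mul_zero]
  rfl

open Classical in
/-- The average number of gates that are not frozen is bounded. -/
theorem exists_expect_not_frozen_le (ha0 : ∀ f, 0 ≤ a f) (ha : ∑ f, a f = 1)
    (ha_neg : ∀ f ∈ classA ∪ classB₂, a f = a (fun x y => !(f x y)))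
    (hac : mass a classC < mass a classA) :
    ∃ D : ℝ, 0 ≤ D ∧ ∀ n : ℕ, 2 ≤ n →
      expect (gateWeight a n) (fun B => (#{i : Fin n | ¬ Frozen B i} : ℝ)) ≤ D := by
  obtain ⟨m, μ, α, β, hμ0, hμ1, -, hβ, h⟩ := exists_expect_paths_le ha0 ha ha_neg hac
  refine ⟨1 + β, by linarith, fun n hn => ?_⟩
  have hn0 : (0 : ℝ) < n := by exact_mod_cast (by omega : 0 < n)
  -- The length may depend on n, since the error term is uniform in it; this choice makes the n
  -- terms μ^l sum to at most 1.
  obtain ⟨l, hl⟩ := exists_pow_lt_of_lt_one (inv_pos.2 hn0) hμ1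
  calc expect (gateWeight a n) (fun B => (#{i : Fin n | ¬ Frozen B i} : ℝ))
      ≤ expect (gateWeight a n) (fun B => ∑ v, paths B m l ∅ v) := by
        refine expect_mono (gateWeight_nonneg ha0) fun B => ?_
        rw [← Finset.sum_boole]
        refine Finset.sum_le_sum fun v _ => ?_
        by_cases hv : Frozen B v
        · simpa [hv] using paths_nonneg _ _ _ _ _
        · simpa [hv] using one_le_paths m l hv
    _ = ∑ v, expect (gateWeight a n) (fun B => paths B m l ∅ v) := expect_sum _ _ _
    _ ≤ ∑ _v : Fin n, ((n : ℝ)⁻¹ + β / n) := by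
        refine Finset.sum_le_sum fun v _ => (h n hn l ∅ v (by simp)).trans ?_
        simpa using hl.le
    _ = 1 + β := by
        rw [Finset.sum_const, Finset.card_univ, Fintype.card_fin, nsmul_eq_mul]
        field_simp

theorem pr_nonneg (ha0 : ∀ f, 0 ≤ a f) (n : ℕ) (P : Automaton n → Prop) : 0 ≤ pr a n P :=
  Finset.sum_nonneg fun B _ => Set.indicator_nonneg
    (fun B _ => Finset.prod_nonneg fun i _ => mul_nonneg (by positivity) (ha0 _)) B

-- Markov's inequality: a cycle with more than 2^k states needs at least k + 1 non-frozen gates.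
open Classical in
theorem pr_hasStateCycleLargerThan_le (ha0 : ∀ f, 0 ≤ a f) {n k : ℕ} {s : ℝ} (hs : 2 ^ k ≤ s) :
    pr a n (fun B => HasStateCycleLargerThan B s) ≤
      (k + 1 : ℝ)⁻¹ * expect (gateWeight a n) (fun B => (#{i : Fin n | ¬ Frozen B i} : ℝ)) := by
  rw [pr_eq_expect, ← expect_const_mul]
  refine expect_mono (gateWeight_nonneg ha0) fun B => ?_
  split_ifs with h
  · obtain ⟨x, hx⟩ := h
    have h1 : ((2 ^ k : ℕ) : ℝ) < ((2 ^ #{i : Fin n | ¬ Frozen B i} : ℕ) : ℝ) := by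
      refine lt_of_le_of_lt ?_ (hx.trans_le (Nat.cast_le.2 (ncard_stateCycle_le B x)))
      exact_mod_cast hs
    have h2 : k < #{i : Fin n | ¬ Frozen B i} :=
      (Nat.pow_lt_pow_iff_right (a := 2) (by norm_num)).1 (by exact_mod_cast h1)
    rw [inv_mul_eq_div, one_le_div (by positivity)]
    exact_mod_cast h2
  · positivity

end Estimates

end BoolAut

theorem corollary4p11
    (a : BoolAut.BoolFn → ℝ)
    (ha_nonneg : ∀ f, 0 ≤ a f)
    (ha_sum : ∑ f, a f = 1)
    (ha_neg : ∀ f ∈ BoolAut.classA ∪ BoolAut.classB₂, a f = a (fun x y => !(f x y)))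
    (ha_swap : ∀ f ∈ BoolAut.classB₁, a f = a (fun x y => f y x))
    (hac : BoolAut.mass a BoolAut.classC < BoolAut.mass a BoolAut.classA)
    (ω : ℕ → ℝ) (hω_mono : Monotone ω) (hω_unbdd : ¬ BddAbove (Set.range ω)) :
    Filter.Tendsto
      (fun n : ℕ => BoolAut.pr a n (fun B => BoolAut.HasStateCycleLargerThan B (ω n)))
      Filter.atTop (nhds 0) := by
  obtain ⟨D, hD, h⟩ := BoolAut.exists_expect_not_frozen_le ha_nonneg ha_sum ha_neg hac
  rw [Metric.tendsto_atTop]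
  intro ε hε
  -- This makes the Markov bound D/(k + 1) smaller than ε; unboundedness and monotonicity then keep
  -- `ω n` above 2^k for large n.
  obtain ⟨k, hk⟩ := exists_nat_gt (D / ε)
  obtain ⟨N, hN⟩ : ∃ N, (2 : ℝ) ^ k ≤ ω N := by
    by_contra! hcon
    exact hω_unbdd ⟨2 ^ k, by rintro _ ⟨i, rfl⟩; exact (hcon i).le⟩
  refine ⟨max N 2, fun n hn => ?_⟩
  rw [Real.dist_eq, sub_zero, abs_of_nonneg (BoolAut.pr_nonneg ha_nonneg _ _)]
  have h1 := BoolAut.pr_hasStateCycleLargerThan_le ha_nonneg (n := n)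
    (hN.trans (hω_mono ((le_max_left _ _).trans hn)))
  refine h1.trans_lt ?_
  have hk0 : (0 : ℝ) < k + 1 := by positivity
  rw [inv_mul_lt_iff₀ hk0]
  refine (h n ((le_max_right _ _).trans hn)).trans_lt ?_
  rw [div_lt_iff₀ hε] at hk
  linarith
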